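/- Let $L=\{<,\dots\}$ be a countable first-order language containing a binary relation symbol $<$, let $\theta$ be a strongly inaccessible cardinal, and let $T$ be an $L$-theory that has a $\theta$-like model $M$, i.e. a model $M$ of cardinality $\theta$ which is strictly linearly ordered by $<$ and in which every element has fewer than $\theta$ predecessors. Let $\lambda$ be a singular cardinal, $\eta=\mathrm{cf}(\lambda)$, and let $\langle\mu_i : i<\eta\rangle$ be a strictly increasing sequence of cardinals with supremum $\lambda$. Let $L^S\supseteq L$ be the Skolem expansion of $L$, obtained by iterating $\omega$ times the addition of Skolem function symbols for all formulas, and let $T_{\mathrm{skolem}}$ be the $L^S$-theory asserting that every formula $\varphi(\bar x,y)$ of $L^S$ has a Skolem function $f$, i.e. $\forall\bar x\,(\exists y\,\varphi(\bar x,y)\to\varphi(\bar x,f(\bar x)))$. Let $L^S(C)$ be $L^S$ with added distinct constant symbols $C=\{c_{ij} : i<\eta,\ j<\mu_i\}$, and order the index pairs $(i,j)$ lexicographically. Let $\Sigma_1$ be the $L^S(C)$-theory with the following axioms. In (iii) and (iv), the index pairs of every sequence of constants to which a term is applied are strictly increasing. (i) $T_{\mathrm{skolem}}$ and the axioms saying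 that $<$ is a strict linear order. (ii) $c_{ij}<c_{kl}$ if $(i,j)<(k,l)$ lexicographically, and $\neg(c_{ij}<c_{kl})$ otherwise. (iii) $\tau(c_{i_1j_1},\dots,c_{i_nj_n})<c_{ij}$ for every $n\ge 0$, every term $\tau(v_1,\dots,v_n)$ of $L^S$ and all indices with $i_1,\dots,i_n<i$. (iv) For every $n\ge 1$, every term $\tau(v_1,\dots,v_n)$ of $L^S$, all $k<i_n\le u$ (with $k,u<\eta$), and all $j,l_1,\dots,l_{n-q}$ for which the constants below exist, the implication $$\tau(c_{i_1j_1},\dots,c_{i_nj_n})<c_{kj}\ \longrightarrow\ \tau(c_{i_1j_1},\dots,c_{i_nj_n})=\tau(c_{i_1j_1},\dots,c_{i_qj_q},c_{ul_1},\dots,c_{ul_{n-q}}),$$ where $q$ is the greatest integer with $i_q\ne i_n$ ($q=0$ if $i_1=\dots=i_n$). Then $T+\Sigma_1$ is consistent, i.e. it has a model. -/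

import Mathlib

universe u v w u'

namespace SingularLike

open FirstOrder FirstOrder.Language Cardinal

/-! ### The Skolem expansion of a language -/

/-- Function symbols of the `m`-th stage of the Skolem expansion: stage `0` has the function symbols
of `L`; stage `m + 1` adds a `k`-ary symbol for each formula `φ(x₀, …, x_{k-1}, y)` of stage `m`. -/
def StageFunctions (L : FirstOrder.Language.{u, v}) : ℕ → ℕ → Type (max u v)
  | 0 => fun k => ULift.{v} (L.Functions k)
  | m + 1 => fun k => StageFunctions L m k ⊕
      BoundedFormula (FirstOrder.Language.mk (StageFunctions L m) L.Relations) Empty (k + 1)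

/-- The `m`-th stage of the Skolem expansion. No relation symbols are added. -/
def stage (L : FirstOrder.Language.{u, v}) (m : ℕ) : FirstOrder.Language.{max u v, v} :=
  ⟨StageFunctions L m, L.Relations⟩

/-- The Skolem expansion `L^S`, the union of all the stages: the symbols of `L`, together with a
Skolem function symbol for each formula `φ(x₀, …, x_{k-1}, y)` of each stage. -/
def skolemLang (L : FirstOrder.Language.{u, v}) : FirstOrder.Language.{max u v, v} :=
  ⟨fun k => L.Functions k ⊕ Σ m : ℕ, (stage L m).BoundedFormula Empty (k + 1), L.Relations⟩

/-- The inclusion of `L` in its Skolem expansion. -/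
def inclusion (L : FirstOrder.Language.{u, v}) : L →ᴸ skolemLang L where
  onFunction := fun _ f => Sum.inl f
  onRelation := fun _ R => R

/-- The inclusion of the function symbols of a stage in those of the Skolem expansion. -/
def stageFunctionsToSkolem (L : FirstOrder.Language.{u, v}) :
    ∀ m k : ℕ, StageFunctions L m k → (skolemLang L).Functions k
  | 0, _ => fun f => Sum.inl f.down
  | m + 1, k => Sum.elim (stageFunctionsToSkolem L m k) (fun φ => Sum.inr ⟨m, φ⟩)

/-- The inclusion of a stage in the Skolem expansion. -/
def stageToSkolem (L : FirstOrder.Language.{u, v}) (m : ℕ) : stage L m →ᴸ skolemLang L where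
  onFunction := fun k f => stageFunctionsToSkolem L m k f
  onRelation := fun _ R => R

/-- The sentence `∀ x₀ … x_{k-1}, (∃ y, φ(x, y)) → φ(x, f(x))`, in which `φ(x, f(x))` is written as
`∃ y, y = f(x) ∧ φ(x, y)`. -/
def skolemAxiom {L : FirstOrder.Language.{u, v}} {k : ℕ} (f : L.Functions k)
    (φ : L.BoundedFormula Empty (k + 1)) : L.Sentence :=
  BoundedFormula.alls (n := k)
    (φ.ex ⟹ (Term.bdEqual (Term.var (Sum.inr (Fin.last k)))
      (Term.func f (fun i : Fin k => Term.var (Sum.inr i.castSucc))) ⊓ φ).ex)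

/-- The Skolem theory: for every formula of the Skolem expansion there is a Skolem function. (Every
formula of `skolemLang L` comes from a formula of some stage.) -/
def skolemTheory (L : FirstOrder.Language.{u, v}) : (skolemLang L).Theory :=
  {σ | ∃ (m k : ℕ) (φ : (stage L m).BoundedFormula Empty (k + 1)),
    σ = skolemAxiom (L := skolemLang L) (k := k) (Sum.inr ⟨m, φ⟩)
      ((stageToSkolem L m).onBoundedFormula φ)}

/-! ### Linear orders -/

/-- The axioms saying that the binary relation symbol `lt` is a strict linear order. -/
def linearOrderAxioms {L : FirstOrder.Language.{u, v}} (lt : L.Relations 2) : L.Theory :=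
  {lt.irreflexive, lt.transitive,
    ∀' ∀' (lt.boundedFormula₂ (&0) (&1) ⊔ Term.bdEqual (&0) (&1) ⊔ lt.boundedFormula₂ (&1) (&0))}

/-- `M`, strictly linearly ordered by `lt`, is `θ`-like: it has cardinality `θ`, and each of its
elements has fewer than `θ` predecessors. -/
structure IsLike {L : FirstOrder.Language.{u, v}} (lt : L.Relations 2) (M : Type w) [L.Structure M]
    (θ : Cardinal.{w}) : Prop where
  linear : IsStrictTotalOrder M (fun a b => Structure.RelMap lt ![a, b])
  card_eq : #M = θ
  card_lt : ∀ a : M, #{b : M // Structure.RelMap lt ![b, a]} < θ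

/-! ### The theory `Σ₁` -/

section Sigma1

variable (L : FirstOrder.Language.{u, v}) (lt : L.Relations 2)
  (I : Type w) [LinearOrder I] (J : I → Type w) [∀ i, LinearOrder (J i)]

/-- The indices `(i, j)` of the constant symbols `c_{ij}`, ordered lexicographically. -/
abbrev Index : Type w := Σₗ i : I, J i

/-- The language `L^S(C)`, where `C` is the set of constant symbols `c_{ij}`, `i ∈ I`, `j ∈ J i`. -/
abbrev constLang : FirstOrder.Language.{max (max u v) w, v} := (skolemLang L)[[Index I J]]

/-- The order symbol of `L^S(C)`. -/
abbrev ltC : (constLang L I J).Relations 2 :=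
  ((skolemLang L).lhomWithConstants (Index I J)).onRelation ((inclusion L).onRelation lt)

variable {I J}

/-- The constant symbol `c_p`, as a closed term. -/
def cst (p : Index I J) : (constLang L I J).Term (Empty ⊕ Fin 0) :=
  ((skolemLang L).con p).term

variable {L}

/-- The closed term `τ(c_{p 0}, …, c_{p (n-1)})`. -/
def termAt {n : ℕ} (τ : (skolemLang L).Term (Fin n)) (p : Fin n → Index I J) :
    (constLang L I J).Term (Empty ⊕ Fin 0) :=
  (((skolemLang L).lhomWithConstants (Index I J)).onTerm τ).subst (fun t => cst L (p t))

/-- The sentence `s < t`. -/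
def ltSentence (s t : (constLang L I J).Term (Empty ⊕ Fin 0)) : (constLang L I J).Sentence :=
  (ltC L lt I J).boundedFormula₂ s t

/-- The sentence `s = t`. -/
def eqSentence (s t : (constLang L I J).Term (Empty ⊕ Fin 0)) : (constLang L I J).Sentence :=
  Term.bdEqual s t

variable (I J)

/-- (i): Skolem's axioms, and the axioms of linear orders. -/
def axiomsI : (constLang L I J).Theory :=
  ((skolemLang L).lhomWithConstants (Index I J)).onTheory (skolemTheory L) ∪
    linearOrderAxioms (ltC L lt I J)

/-- (ii): `c_p < c_p'` if and only if `p < p'` lexicographically. -/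
def axiomsII : (constLang L I J).Theory :=
  {σ | ∃ p p' : Index I J, p < p' ∧ σ = ltSentence lt (cst L p) (cst L p')} ∪
  {σ | ∃ p p' : Index I J, ¬ p < p' ∧ σ = ∼(ltSentence lt (cst L p) (cst L p'))}

/-- (iii): `τ(c_{i₁ j₁}, …, c_{iₙ jₙ}) < c_{ij}` whenever `i₁, …, iₙ < i`. -/
def axiomsIII : (constLang L I J).Theory :=
  {σ | ∃ (n : ℕ) (τ : (skolemLang L).Term (Fin n)) (p : Fin n → Index I J) (i : I) (j : J i),
    StrictMono p ∧ (∀ t, (ofLex (p t)).1 < i) ∧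
    σ = ltSentence lt (termAt τ p) (cst L (toLex ⟨i, j⟩))}

/-- (iv): `τ(c_p) < c_{kj} → τ(c_p) = τ(c_{p'})` for increasing sequences `p, p'` of length
`n + 1`, where `k < i_last`, the first index of the last term of `p`, and where `p'` arises from `p`
by replacing the terms with first index `i_last` by terms with first index `u`, for some
`u ≥ i_last`. If `i_last` has a predecessor, the axioms with `k < i_last - 1` follow, given the other
axioms, from those with `k = i_last - 1`. -/
def axiomsIV : (constLang L I J).Theory :=
  {σ | ∃ (n : ℕ) (τ : (skolemLang L).Term (Fin (n + 1))) (p p' : Fin (n + 1) → Index I J)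
      (k : I) (j : J k) (u : I),
    StrictMono p ∧ StrictMono p' ∧
    k < (ofLex (p (Fin.last n))).1 ∧ (ofLex (p (Fin.last n))).1 ≤ u ∧
    (∀ t, (ofLex (p t)).1 ≠ (ofLex (p (Fin.last n))).1 → p' t = p t) ∧
    (∀ t, (ofLex (p t)).1 = (ofLex (p (Fin.last n))).1 → (ofLex (p' t)).1 = u) ∧
    σ = (ltSentence lt (termAt τ p) (cst L (toLex ⟨k, j⟩)) ⟹
      eqSentence (termAt τ p) (termAt τ p'))}

/-- The theory `Σ₁`. -/
def sigmaOne : (constLang L I J).Theory :=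
  axiomsI lt I J ∪ axiomsII lt I J ∪ axiomsIII lt I J ∪ axiomsIV lt I J

end Sigma1

/-- An `L`-theory, as an `L^S(C)`-theory. -/
def liftTheory {L : FirstOrder.Language.{u, v}} (T : L.Theory) (I : Type w) [LinearOrder I] (J : I → Type w)
    [∀ i, LinearOrder (J i)] : (constLang L I J).Theory :=
  (((skolemLang L).lhomWithConstants (Index I J)).comp (inclusion L)).onTheory T

end SingularLike

/-! A finite part of the theory mentions finitely many constants and terms, so by compactness it is
enough to interpret finitely many constants `c_{ij}` in the given `θ`-like model `M`, expanded by
Skolem functions, so that the axioms on finitely many terms hold.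

The constants with the same first index form a block, and the blocks are chosen one after the other.
A block can be put above any given finite set, such as the earlier blocks and the values of the
terms at them, because `M` is `θ`-like; this gives `axiomsII` and `axiomsIII`. For `axiomsIV`,
consider the values of the terms at earlier elements `a` and at a finite set `y` of points still to be
chosen, and record such a value only if it lies below some earlier element. This colours the finite
sets `y` with fewer than `θ` colours, as `θ` is a strong limit. By the Erdős–Rado theorem
(`exists_homogeneous_of_isStrongLimit`), every large enough set has homogeneous subsets of any given
size below `θ`. One homogeneous set would not do for all later blocks, since `θ` need not be weakly
compact: the choice of the next block may raise the number of colours beyond the size of that set.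
What is carried along instead is a family of sets, with members of all sizes below `θ`, which are
homogeneous in the same way. As `θ` is regular, such a family can be thinned out again after each choice of a block
(`IsLarge.exists_refinement`), and `exists_blocks` iterates this. All later blocks are taken from
members of the family, so a part of one block can be replaced by an equally large part of any later
block without changing the recorded values. -/

namespace SingularLike

open FirstOrder FirstOrder.Language Cardinal

/-! ### Homogeneous sets -/

theorem mk_fun_lt_of_isStrongLimit {θ : Cardinal.{u}} (hθ : θ.IsStrongLimit) {α β : Type u}
    (hα : #α < θ) (hβ : #β < θ) : #(α → β) < θ := by
  have hinj : Function.Injective fun (f : α → β) => {p : α × β | f p.1 = p.2} := by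
    intro f g h
    funext a
    have : (a, f a) ∈ {p : α × β | g p.1 = p.2} := by
      rw [← show _ = {p : α × β | g p.1 = p.2} from h]; rfl
    exact this.symm
  refine (mk_le_of_injective hinj).trans_lt ?_
  rw [mk_set, mk_prod, lift_id, lift_id]
  exact hθ.isStrongPrelimit (mul_lt_of_lt hθ.aleph0_le hα hβ)

theorem mk_finset_lt_of_isStrongLimit {θ : Cardinal.{u}} (hθ : θ.IsStrongLimit) {α : Type u}
    (hα : #α < θ) : #(Finset α) < θ := by
  refine (mk_le_of_injective (Finset.coe_injective (α := α))).trans_lt ?_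
  rw [mk_set]
  exact hθ.isStrongPrelimit hα

section EndHomogeneous

open Classical in
/-- A sequence of elements of `X`, defined by recursion along the well-order `Γ`, which the point `x`
guides: the term at `γ` is chosen to be distinct from the previous terms and to have the same
`f`-colours over finite sets of previous terms as `x` has. The choice depends on `x` only through
these colours. -/
noncomputable def guidedSeq {X C Γ : Type u} [Nonempty X] [LinearOrder Γ] [WellFoundedLT Γ]
    (f : Finset X → C) (x : X) (γ : Γ) : X :=
  Classical.epsilon fun z => (∀ δ : {δ // δ < γ}, z ≠ guidedSeq f x δ.1) ∧
    ∀ s : Finset {δ // δ < γ}, f (insert z (s.image fun δ => guidedSeq f x δ.1)) =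
      f (insert x (s.image fun δ => guidedSeq f x δ.1))
termination_by wellFounded_lt.wrap γ
decreasing_by all_goals exact δ.2

variable {X C Γ : Type u} [Nonempty X] [LinearOrder Γ] [WellFoundedLT Γ]

open Classical in
/-- The colours of `x` over its own sequence determine this sequence. If `x` occurs in the sequence,
they determine `x` together with its position. -/
theorem guidedSeq_congr (f : Finset X → C) {x x' : X}
    (h : ∀ s : Finset Γ, f (insert x (s.image (guidedSeq f x))) =
      f (insert x' (s.image (guidedSeq f x')))) (γ : Γ) :
    guidedSeq f x γ = guidedSeq f x' γ := by
  induction γ using WellFoundedLT.induction with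
  | ind γ ih =>
    have key : (fun δ : {δ // δ < γ} => guidedSeq f x δ.1) = fun δ => guidedSeq f x' δ.1 :=
      funext fun δ => ih δ.1 δ.2
    have hs : ∀ s : Finset {δ // δ < γ}, f (insert x (s.image fun δ => guidedSeq f x' δ.1)) =
        f (insert x' (s.image fun δ => guidedSeq f x' δ.1)) := by
      intro s
      have := h (s.image Subtype.val)
      rw [Finset.image_image, Finset.image_image] at this
      rw [← key]
      refine this.trans ?_
      rw [key]
      rfl
    rw [guidedSeq, guidedSeq]
    congr 1
    funext z
    have h1 : ∀ δ : {δ // δ < γ}, guidedSeq f x δ.1 = guidedSeq f x' δ.1 := fun δ => ih δ.1 δ.2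
    simp only [h1, hs]

open Classical in
/-- A large enough set contains an end-homogeneous sequence of a given length: some point `x` looks
like each term of the sequence over the previous terms. -/
theorem exists_endHomogeneous (f : Finset X → C) (hX : #(Γ × (Finset Γ → C)) < #X) :
    ∃ (x : X) (h : Γ → X), Function.Injective h ∧ ∀ (γ : Γ) (s : Finset Γ), (∀ δ ∈ s, δ < γ) →
      f (insert (h γ) (s.image h)) = f (insert x (s.image h)) := by
  by_cases hx : ∃ x : X, ∀ γ : Γ, x ≠ guidedSeq f x γ
  · obtain ⟨x, hx⟩ := hx
    have spec : ∀ γ : Γ, (∀ δ : {δ // δ < γ}, guidedSeq f x γ ≠ guidedSeq f x δ.1) ∧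
        ∀ s : Finset {δ // δ < γ},
          f (insert (guidedSeq f x γ) (s.image fun δ => guidedSeq f x δ.1)) =
            f (insert x (s.image fun δ => guidedSeq f x δ.1)) := by
      intro γ
      rw [guidedSeq]
      exact Classical.epsilon_spec (p := fun z => (∀ δ : {δ // δ < γ}, z ≠ guidedSeq f x δ.1) ∧
        ∀ s : Finset {δ // δ < γ}, f (insert z (s.image fun δ => guidedSeq f x δ.1)) =
          f (insert x (s.image fun δ => guidedSeq f x δ.1))) ⟨x, fun δ => hx _, fun _ => rfl⟩
    refine ⟨x, guidedSeq f x, ?_, ?_⟩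
    · intro γ δ hγδ
      by_contra hne
      rcases lt_or_gt_of_ne hne with hlt | hlt
      · exact (spec δ).1 ⟨γ, hlt⟩ hγδ.symm
      · exact (spec γ).1 ⟨δ, hlt⟩ hγδ
    · intro γ s hs
      have := (spec γ).2 (s.subtype (· < γ))
      have him : (s.subtype (· < γ)).image (fun δ => guidedSeq f x δ.1) =
          s.image (guidedSeq f x) := by
        conv_rhs => rw [← Finset.subtype_map_of_mem hs, Finset.map_eq_image, Finset.image_image]
        rfl
      rwa [him] at this
  -- otherwise each `x` occurs in its own sequence, and is coded by its position and its colours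
  · push Not at hx
    choose pos hpos using hx
    exfalso
    refine hX.not_ge (mk_le_of_injective
      (f := fun x => (pos x, fun s : Finset Γ => f (insert x (s.image (guidedSeq f x))))) ?_)
    intro x x' hxx
    rw [Prod.mk.injEq] at hxx
    rw [hpos x, hpos x', hxx.1]
    exact guidedSeq_congr f (fun s => congrFun hxx.2 s) _

end EndHomogeneous

/-- A weak form of the Erdős–Rado theorem, for colourings of finite sets by fewer than `θ` colours,
where `θ` is a strong limit. -/
theorem exists_homogeneous_of_isStrongLimit {θ : Cardinal.{u}} (hθ : θ.IsStrongLimit) {C : Type u}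
    (hC : #C < θ) (n : ℕ) : ∀ κ < θ, ∃ ν < θ, ∀ X : Type u, ν ≤ #X → ∀ f : Finset X → C,
      ∃ H : Set X, κ ≤ #H ∧ ∃ c : ℕ → C, ∀ s : Finset X, ↑s ⊆ H → s.card ≤ n → f s = c s.card := by
  classical
  induction n with
  | zero =>
    intro κ hκ
    refine ⟨κ, hκ, fun X hX f => ⟨Set.univ, by simpa using hX, fun _ => f ∅, ?_⟩⟩
    intro s _ hs
    rw [Finset.card_eq_zero.1 (Nat.le_zero.1 hs)]
  | succ n ih =>
    intro κ hκ
    obtain ⟨ν, hν, ih⟩ := ih κ hκ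
    let Γ := ν.ord.ToType
    have hΓ : #Γ = ν := mk_ord_toType ν
    have hΓθ : #Γ < θ := hΓ ▸ hν
    have hcode : #(Γ × (Finset Γ → C)) < θ := by
      rw [mk_prod, lift_id, lift_id]
      exact mul_lt_of_lt hθ.aleph0_le hΓθ
        (mk_fun_lt_of_isStrongLimit hθ (mk_finset_lt_of_isStrongLimit hθ hΓθ) hC)
    refine ⟨Order.succ #(Γ × (Finset Γ → C)), hθ.isSuccLimit.succ_lt hcode, fun X hX f => ?_⟩
    have hX' := Order.succ_le_iff.1 hX
    have : Nonempty X := mk_ne_zero_iff.1 (ne_bot_of_gt hX')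
    obtain ⟨x, h, hinj, hh⟩ := exists_endHomogeneous f hX'
    obtain ⟨H, hH, c, hc⟩ := ih Γ hΓ.ge fun s => f (insert x (s.image h))
    -- for nonempty `s`, the largest element of `h '' s` may be replaced by `x`
    refine ⟨h '' H, by rwa [mk_image_eq hinj], fun m => if m = 0 then f ∅ else c (m - 1), ?_⟩
    intro t ht htn
    obtain ⟨s, hs, rfl⟩ := Finset.subset_set_image_iff.1 ht
    rw [Finset.card_image_of_injective _ hinj] at htn ⊢
    rcases s.eq_empty_or_nonempty with rfl | hne
    · simp
    · have hcard := hne.card_pos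
      have hmax := s.max'_mem hne
      have hf : f (s.image h) = f (insert x ((s.erase (s.max' hne)).image h)) := by
        rw [← hh (s.max' hne) _ fun δ hδ => s.lt_max'_of_mem_erase_max' hne hδ,
          ← Finset.image_insert, Finset.insert_erase hmax]
      have hcard' := Finset.card_erase_of_mem hmax
      rw [hf]
      refine (hc _ (fun y hy => hs (Finset.mem_of_mem_erase hy)) (by omega)).trans ?_
      simp only [hcard.ne', if_false, hcard']

/-! ### Blocks of indiscernibles in a `θ`-like order -/

section Blocks

variable {M : Type u'}

/-- A family of sets is large if it has members of every size below `θ`. -/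
def IsLarge (θ : Cardinal.{u'}) (𝓕 : Set (Set M)) : Prop :=
  ∀ κ < θ, ∃ H ∈ 𝓕, κ ≤ #H

/-- For `a ⊆ P` and for at most `N` points `y` from one member of `𝓕`, a value `val k (a ∪ y)` that
lies below some element of `P` depends only on `k`, on `a` and on the number of these points, and
neither on the points nor on the member. -/
def IsUniformOver [LinearOrder M] {K : Type*} (val : K → Finset M → M) (N : ℕ) (P : Finset M)
    (𝓕 : Set (Set M)) : Prop :=
  ∀ H ∈ 𝓕, ∀ H' ∈ 𝓕, ∀ y y' : Finset M, ↑y ⊆ H → ↑y' ⊆ H' →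
    y.card = y'.card → y.card ≤ N →
      ∀ k, ∀ a ⊆ P, ∀ q ∈ P, val k (a ∪ y) < q → val k (a ∪ y') = val k (a ∪ y)

variable [LinearOrder M] {θ : Cardinal.{u'}} {K : Type u'} [Finite K]

theorem mk_setOf_exists_lt_lt (hθ : ℵ₀ ≤ θ) (hM : ∀ a : M, #(Set.Iio a) < θ) (P : Finset M) :
    #{b : M | ∃ q ∈ P, b < q} < θ := by
  rcases P.eq_empty_or_nonempty with rfl | hP
  · simpa using aleph0_pos.trans_le hθ
  · refine (mk_le_mk_of_subset ?_).trans_lt (hM (P.max' hP))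
    rintro b ⟨q, hq, hb⟩
    exact hb.trans_le (P.le_max' q hq)

theorem mk_setOf_exists_le_lt (hθ : ℵ₀ ≤ θ) (hM : ∀ a : M, #(Set.Iio a) < θ) (P : Finset M) :
    #{b : M | ∃ q ∈ P, b ≤ q} < θ := by
  have hsub : {b : M | ∃ q ∈ P, b ≤ q} ⊆ {b : M | ∃ q ∈ P, b < q} ∪ ↑P := by
    rintro b ⟨q, hq, hb⟩
    rcases hb.lt_or_eq with h | rfl
    · exact Or.inl ⟨q, hq, h⟩
    · exact Or.inr hq
  refine ((mk_le_mk_of_subset hsub).trans (mk_union_le _ _)).trans_lt ?_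
  refine add_lt_of_lt hθ (mk_setOf_exists_lt_lt hθ hM P) ?_
  exact (lt_aleph0_of_finite _).trans_le hθ

/-- A large family contains a block of `N` elements, in one of its members, above a given finite
set. -/
theorem IsLarge.exists_block (hθ : θ.IsInaccessible) (hM : ∀ a : M, #(Set.Iio a) < θ)
    {𝓕 : Set (Set M)} (h𝓕 : IsLarge θ 𝓕) (U : Finset M) (N : ℕ) :
    ∃ A : Finset M, A.card = N ∧ (∃ H ∈ 𝓕, ↑A ⊆ H) ∧ ∀ u ∈ U, ∀ y ∈ A, u < y := by
  have hinf := hθ.isStrongLimit.aleph0_le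
  let V := {b : M | ∃ q ∈ U, b ≤ q}
  obtain ⟨H, hH, hcard⟩ := h𝓕 (Order.succ (#V + ℵ₀)) (hθ.isSuccLimit.succ_lt
    (add_lt_of_lt hinf (mk_setOf_exists_le_lt hinf hM U) hθ.aleph0_lt))
  have hdiff : (N : Cardinal) ≤ #(H \ V : Set M) := by
    by_contra hlt
    push Not at hlt
    have hle : #H ≤ #V + #(H \ V : Set M) := by
      refine (mk_le_mk_of_subset ?_).trans (mk_union_le V (H \ V))
      rw [Set.union_sdiff_self]
      exact Set.subset_union_right
    have hle' : #V + #(H \ V : Set M) ≤ #V + ℵ₀ := by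
      gcongr
      exact hlt.le.trans natCast_le_aleph0
    exact (Order.succ_le_iff.1 hcard).not_ge (hle.trans hle')
  obtain ⟨s, hs, hsN⟩ := (le_mk_iff_exists_subset (c := (N : Cardinal)) (s := H \ V)).1 hdiff
  have hsfin : s.Finite := lt_aleph0_iff_set_finite.1 (hsN ▸ natCast_lt_aleph0)
  refine ⟨hsfin.toFinset, ?_, ⟨H, hH, ?_⟩, ?_⟩
  · have := hsN
    rw [← hsfin.coe_toFinset, Finset.coe_sort_coe, mk_coe_finset] at this
    exact_mod_cast this
  · rw [hsfin.coe_toFinset]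
    exact fun x hx => (hs hx).1
  · intro q hq y hy
    have := (hs (hsfin.mem_toFinset.1 hy)).2
    by_contra hlt
    exact this ⟨q, hq, not_lt.1 hlt⟩

/-- A large family can be refined to a large family that is uniform over a given finite set: thin
out its members by the Erdős–Rado theorem; there are fewer than `θ` ways for a homogeneous set to be
coloured, so, as `θ` is regular, one of them occurs for homogeneous sets of all sizes. -/
theorem IsLarge.exists_refinement (hθ : θ.IsInaccessible) (hM : ∀ a : M, #(Set.Iio a) < θ)
    {𝓕 : Set (Set M)} (h𝓕 : IsLarge θ 𝓕) (val : K → Finset M → M) (N : ℕ) (P : Finset M) :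
    ∃ 𝓖 : Set (Set M), IsLarge θ 𝓖 ∧ IsUniformOver val N P 𝓖 ∧ ∀ G ∈ 𝓖, ∃ H ∈ 𝓕, G ⊆ H := by
  have hinf := hθ.isStrongLimit.aleph0_le
  let V := {b : M | ∃ q ∈ P, b < q}
  have hV : #V < θ := mk_setOf_exists_lt_lt hinf hM P
  -- the colour `none` stands for all the values that do not lie below an element of `P`
  let C := K × {a // a ∈ P.powerset} → Option V
  have hC : #C < θ := by
    refine mk_fun_lt_of_isStrongLimit hθ.isStrongLimit ((lt_aleph0_of_finite _).trans_le hinf) ?_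
    rw [mk_option]
    exact add_lt_of_lt hinf hV (one_lt_aleph0.trans_le hinf)
  let f : Finset M → C := fun y p =>
    if h : val p.1 (p.2.1 ∪ y) ∈ V then some ⟨_, h⟩ else none
  let Col : (ULift.{u'} ℕ → C) → Set M → Prop := fun c G =>
    ∀ y : Finset M, ↑y ⊆ G → y.card ≤ N → f y = c ⟨y.card⟩
  have hcol : ∀ κ < θ, ∃ (c : ULift.{u'} ℕ → C) (G : Set M), Col c G ∧ (∃ H ∈ 𝓕, G ⊆ H) ∧
      κ ≤ #G := by
    intro κ hκ
    obtain ⟨ν, hν, h⟩ := exists_homogeneous_of_isStrongLimit hθ.isStrongLimit hC N κ hκ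
    obtain ⟨H, hH, hνH⟩ := h𝓕 ν hν
    obtain ⟨G, hG, c, hc⟩ := h H hνH fun s => f (s.map (Function.Embedding.subtype _))
    refine ⟨fun m => c m.down, Subtype.val '' G, ?_, ⟨H, hH, ?_⟩, ?_⟩
    · intro y hy hyN
      obtain ⟨s, hs, rfl⟩ := Finset.subset_set_image_iff.1 hy
      have := hc s hs
      rw [Finset.card_image_of_injective _ Subtype.val_injective] at hyN ⊢
      have h' := this hyN
      rw [Finset.map_eq_image] at h'
      exact h'
    · rintro _ ⟨x, _, rfl⟩
      exact x.2
    · rwa [mk_image_eq Subtype.val_injective]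
  obtain ⟨c, hc⟩ : ∃ c, IsLarge θ {G | Col c G ∧ ∃ H ∈ 𝓕, G ⊆ H} := by
    by_contra hno
    simp only [IsLarge] at hno
    push Not at hno
    choose κ hκ hno using hno
    have hCs : #(ULift.{u'} ℕ → C) < θ := by
      refine mk_fun_lt_of_isStrongLimit hθ.isStrongLimit ?_ hC
      simpa using hθ.aleph0_lt
    have hsup := sum_lt_of_isRegular hθ.isRegular hCs hκ
    obtain ⟨c, G, hG, hGH, hle⟩ := hcol _ hsup
    exact absurd ((le_sum κ c).trans hle) (hno c G ⟨hG, hGH⟩).not_ge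
  refine ⟨_, hc, ?_, fun G hG => hG.2⟩
  intro G hG G' hG' y y' hy hy' hcard hN k a ha q hq hlt
  have hff : f y = f y' := by
    rw [hG.1 y hy hN, hG'.1 y' hy' (hcard ▸ hN), hcard]
  have := congrFun hff (k, ⟨a, Finset.mem_powerset.2 ha⟩)
  have hmem : val k (a ∪ y) ∈ V := ⟨q, hq, hlt⟩
  simp only [f, dif_pos hmem] at this
  split_ifs at this with h
  exact (congrArg Subtype.val (Option.some.inj this)).symm

/-- In a `θ`-like order there are blocks `A 0 < A 1 < ⋯` of `N` elements each, such that the values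
of the functions `val k` at earlier elements lie below each block, and such that their values at
earlier elements `a` and a part `y` of a block, when they lie below an earlier element, are the same
for any part of any later block that has as many elements as `y`. The set `P t` consists of the
elements before the block `A t`. -/
theorem exists_blocks (hθ : θ.IsInaccessible) (hM : ∀ a : M, #(Set.Iio a) < θ) (hcard : #M = θ)
    (val : K → Finset M → M) (N : ℕ) :
    ∃ A P : ℕ → Finset M, (∀ t, (A t).card = N) ∧ (∀ s t, s < t → A s ⊆ P t) ∧
      (∀ t, ∀ x ∈ P t, ∀ y ∈ A t, x < y) ∧
      (∀ t k, ∀ a ⊆ P t, ∀ y ∈ A t, val k a < y) ∧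
      ∀ t s s', t ≤ s → t ≤ s' → ∀ y ⊆ A s, ∀ y' ⊆ A s', y.card = y'.card →
        ∀ k, ∀ a ⊆ P t, ∀ q ∈ P t, val k (a ∪ y) < q → val k (a ∪ y') = val k (a ∪ y) := by
  have := Fintype.ofFinite K
  have step : ∀ S : {S : Finset M × Set (Set M) // IsLarge θ S.2 ∧ IsUniformOver val N S.1 S.2},
      ∃ (A : Finset M)
        (S' : {S : Finset M × Set (Set M) // IsLarge θ S.2 ∧ IsUniformOver val N S.1 S.2}),
        A.card = N ∧ (∃ H ∈ S.1.2, ↑A ⊆ H) ∧ (∀ x ∈ S.1.1, ∀ y ∈ A, x < y) ∧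
        (∀ k, ∀ a ⊆ S.1.1, ∀ y ∈ A, val k a < y) ∧
        S'.1.1 = S.1.1 ∪ A ∧ ∀ G ∈ S'.1.2, ∃ H ∈ S.1.2, G ⊆ H := by
    rintro ⟨⟨P, 𝓕⟩, h𝓕, -⟩
    obtain ⟨A, hAN, hA, hlt⟩ := h𝓕.exists_block hθ hM
      (P ∪ (Finset.univ ×ˢ P.powerset).image fun p : K × Finset M => val p.1 p.2) N
    obtain ⟨𝓖, h𝓖, hunif, hsub⟩ := h𝓕.exists_refinement hθ hM val N (P ∪ A)
    refine ⟨A, ⟨⟨P ∪ A, 𝓖⟩, h𝓖, hunif⟩, hAN, hA, ?_, ?_, rfl, hsub⟩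
    · exact fun x hx => hlt x (Finset.mem_union_left _ hx)
    · intro k a ha
      refine hlt _ (Finset.mem_union_right _ (Finset.mem_image.2 ⟨(k, a), ?_, rfl⟩))
      simpa using ha
  choose A next hAN hAH hAP hAval hnext hsub using step
  have hstart : IsLarge θ ({Set.univ} : Set (Set M)) ∧
      IsUniformOver val N ∅ ({Set.univ} : Set (Set M)) := by
    refine ⟨fun κ hκ => ⟨Set.univ, rfl, ?_⟩, ?_⟩
    · rw [mk_univ, hcard]
      exact hκ.le
    · intro H _ H' _ y y' _ _ _ _ k a _ q hq
      simp at hq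
  let S : ℕ → {S : Finset M × Set (Set M) // IsLarge θ S.2 ∧ IsUniformOver val N S.1 S.2} :=
    fun t => Nat.rec ⟨(∅, {Set.univ}), hstart⟩ (fun _ => next) t
  have hmono : ∀ t s, t ≤ s → ∀ G ∈ (S s).1.2, ∃ H ∈ (S t).1.2, G ⊆ H := by
    intro t s hts
    induction s, hts using Nat.le_induction with
    | base => exact fun G hG => ⟨G, hG, subset_rfl⟩
    | succ s _ ih =>
      intro G hG
      obtain ⟨G', hG', hGG'⟩ := hsub (S s) G hG
      obtain ⟨H, hH, hGH⟩ := ih G' hG'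
      exact ⟨H, hH, hGG'.trans hGH⟩
  have hin : ∀ t s, t ≤ s → ∃ H ∈ (S t).1.2, ↑(A (S s)) ⊆ H := by
    intro t s hts
    obtain ⟨G, hG, hAG⟩ := hAH (S s)
    obtain ⟨H, hH, hGH⟩ := hmono t s hts G hG
    exact ⟨H, hH, hAG.trans hGH⟩
  refine ⟨fun t => A (S t), fun t => (S t).1.1, fun t => hAN _, ?_, fun t => hAP _,
    fun t => hAval _, ?_⟩
  · intro s t hst
    induction t, hst using Nat.le_induction with
    | base => exact Finset.subset_union_right.trans (hnext (S s)).ge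
    | succ t _ ih => exact ih.trans (Finset.subset_union_left.trans (hnext (S t)).ge)
  · intro t s s' hs hs' y hy y' hy' hcard k a ha q hq hlt
    obtain ⟨H, hH, hAH⟩ := hin t s hs
    obtain ⟨H', hH', hAH'⟩ := hin t s' hs'
    exact (S t).2.2 H hH H' hH' y y' (fun x hx => hAH (hy hx)) (fun x hx => hAH' (hy' hx)) hcard
      ((Finset.card_le_card hy).trans (hAN _).le) k a ha q hq hlt

end Blocks

/-! ### Interpretation of finitely many constants -/

/-- The properties of an interpretation `c` of the constants indexed by `D` that correspond to
`axiomsII`, `axiomsIII` and `axiomsIV`. A tuple of constants enters through the set of its values: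
an increasing tuple is determined by this set. In `val_eq`, the finite sets `s`, `r` and `r'` index
the constants that are kept, replaced and substituted. -/
structure IsGenericOn {M : Type u'} [LinearOrder M] {K : Type*} (val : K → Finset M → M)
    (F : Finset K) {I : Type w} [LinearOrder I] {J : I → Type w} [∀ i, LinearOrder (J i)]
    (D : Finset (Index I J)) (c : Index I J → M) : Prop where
  lt : ∀ p ∈ D, ∀ q ∈ D, p < q → c p < c q
  val_lt : ∀ k ∈ F, ∀ s ⊆ D, ∀ q ∈ D, (∀ p ∈ s, (ofLex p).1 < (ofLex q).1) →
    val k (s.image c) < c q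
  val_eq : ∀ k ∈ F, ∀ s ⊆ D, ∀ (r r' : Finset (Index I J)) (i j : I), i ≤ j →
    (∀ p ∈ s, (ofLex p).1 < i) → (∀ p ∈ r, (ofLex p).1 = i) → (∀ p ∈ r', (ofLex p).1 = j) →
    (r.image c).card = (r'.image c).card → ∀ q ∈ D, (ofLex q).1 < i →
    val k (s.image c ∪ r.image c) < c q →
    val k (s.image c ∪ r'.image c) = val k (s.image c ∪ r.image c)

theorem IsGenericOn.mono {M : Type u'} [LinearOrder M] {K : Type*} {val : K → Finset M → M}
    {F F' : Finset K} {I : Type w} [LinearOrder I] {J : I → Type w} [∀ i, LinearOrder (J i)]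
    {D D' : Finset (Index I J)} {c : Index I J → M} (h : IsGenericOn val F' D' c) (hF : F ⊆ F')
    (hD : D ⊆ D') : IsGenericOn val F D c where
  lt p hp q hq := h.lt p (hD hp) q (hD hq)
  val_lt k hk s hs q hq := h.val_lt k (hF hk) s (hs.trans hD) q (hD hq)
  val_eq k hk s hs r r' i j hij hsi hr hr' hrr q hq :=
    h.val_eq k (hF hk) s (hs.trans hD) r r' i j hij hsi hr hr' hrr q (hD hq)

/-- The blocks of `exists_blocks` are used up to the finitely many levels of the indices in `D`: a
constant of the `t`-th of these levels goes to the `t`-th block, and its position in this block is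
the number of smaller members of `D`. -/
theorem exists_isGenericOn {M : Type u'} [LinearOrder M] {θ : Cardinal.{u'}} {K : Type*}
    (hθ : θ.IsInaccessible) (hM : ∀ a : M, #(Set.Iio a) < θ) (hcard : #M = θ)
    (val : K → Finset M → M) (F : Finset K) {I : Type w} [LinearOrder I] {J : I → Type w}
    [∀ i, LinearOrder (J i)] (D : Finset (Index I J)) :
    ∃ c : Index I J → M, IsGenericOn val F D c := by
  obtain ⟨A, P, hA, hAP, hlt, hval, hunif⟩ := exists_blocks hθ hM hcard
    (fun k : ULift.{u'} (Fin F.card) => val (F.equivFin.symm k.down)) (D.card + 1)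
  replace hval : ∀ t, ∀ k ∈ F, ∀ a ⊆ P t, ∀ y ∈ A t, val k a < y := by
    intro t k hk
    simpa using hval t ⟨F.equivFin ⟨k, hk⟩⟩
  replace hunif : ∀ t s s', t ≤ s → t ≤ s' → ∀ y ⊆ A s, ∀ y' ⊆ A s', y.card = y'.card →
      ∀ k ∈ F, ∀ a ⊆ P t, ∀ q ∈ P t, val k (a ∪ y) < q → val k (a ∪ y') = val k (a ∪ y) := by
    intro t s s' hs hs' y hy y' hy' hcard k hk
    simpa using hunif t s s' hs hs' y hy y' hy' hcard ⟨F.equivFin ⟨k, hk⟩⟩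
  -- `e i` counts the levels of members of `D` below `i`, and `pos p` the members of `D` below `p`
  let e : I → ℕ := fun i => ((D.image fun p => (ofLex p).1).filter (· < i)).card
  let pos : Index I J → ℕ := fun p => (D.filter (· < p)).card
  have he : Monotone e := fun i j hij => Finset.card_le_card
    (Finset.monotone_filter_right _ fun x _ hx => hx.trans_le hij)
  have he' : ∀ p ∈ D, ∀ j, (ofLex p).1 < j → e (ofLex p).1 < e j := by
    intro p hp j hj
    refine Finset.card_lt_card (Finset.ssubset_iff_subset_ne.2
      ⟨Finset.monotone_filter_right _ fun x _ hx => hx.trans hj, fun h => ?_⟩)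
    have : (ofLex p).1 ∈ (D.image fun p => (ofLex p).1).filter (· < j) :=
      Finset.mem_filter.2 ⟨Finset.mem_image_of_mem _ hp, hj⟩
    rw [← h] at this
    exact lt_irrefl _ (Finset.mem_filter.1 this).2
  have hposlt : ∀ p, pos p < D.card + 1 := fun p => Nat.lt_succ_of_le (Finset.card_filter_le _ _)
  have hpos : ∀ p ∈ D, ∀ q, p < q → pos p < pos q := by
    intro p hp q hpq
    refine Finset.card_lt_card (Finset.ssubset_iff_subset_ne.2
      ⟨Finset.monotone_filter_right _ fun x _ hx => hx.trans hpq, fun h => ?_⟩)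
    have : p ∈ D.filter (· < q) := Finset.mem_filter.2 ⟨hp, hpq⟩
    rw [← h] at this
    exact lt_irrefl _ (Finset.mem_filter.1 this).2
  let c : Index I J → M := fun p => (A (e (ofLex p).1)).orderEmbOfFin (hA _) ⟨pos p, hposlt p⟩
  have hcA : ∀ p, c p ∈ A (e (ofLex p).1) := fun p => Finset.orderEmbOfFin_mem _ _ _
  have hcP : ∀ p ∈ D, ∀ j, (ofLex p).1 < j → c p ∈ P (e j) :=
    fun p hp j hj => hAP _ _ (he' p hp j hj) (hcA p)
  have himP : ∀ s ⊆ D, ∀ j, (∀ p ∈ s, (ofLex p).1 < j) → s.image c ⊆ P (e j) :=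
    fun s hs j hj => Finset.image_subset_iff.2 fun p hp => hcP p (hs hp) j (hj p hp)
  refine ⟨c, ?_, ?_, ?_⟩
  · intro p hp q hq hpq
    rcases (Sigma.Lex.le_def.1 hpq.le) with h | ⟨h, -⟩
    · exact hlt _ _ (hcP p hp _ h) _ (hcA q)
    · have key : ∀ (t t' : ℕ) (m m' : Fin (D.card + 1)), t = t' → m < m' →
          (A t).orderEmbOfFin (hA _) m < (A t').orderEmbOfFin (hA _) m' := by
        rintro t _ m m' rfl hm
        exact (Finset.orderEmbOfFin _ _).strictMono hm
      exact key _ _ _ _ (congrArg e h) (hpos p hp q hpq)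
  · exact fun k hk s hs q hq hsq => hval _ k hk _ (himP s hs _ hsq) _ (hcA q)
  · intro k hk s hs r r' i j hij hsi hr hr' hrr q hq hqi hlt'
    refine hunif (e i) (e i) (e j) le_rfl (he hij) _ ?_ _ ?_ hrr k hk _ (himP s hs i hsi) _
      (hcP q hq i hqi) hlt'
    · exact Finset.image_subset_iff.2 fun p hp => hr p hp ▸ hcA p
    · exact Finset.image_subset_iff.2 fun p hp => hr' p hp ▸ hcA p

/-! ### The Skolem expansion of a structure -/

section SkolemStructure

variable (L : FirstOrder.Language.{u, v}) (M : Type u') [L.Structure M] [Nonempty M]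

/-- The interpretation of the function symbols of a stage of the Skolem expansion: a symbol for
`φ(x, y)` sends `x` to some `y` with `φ(x, y)`, if there is one. -/
noncomputable def stageFunMap : ∀ (m : ℕ) {k : ℕ}, StageFunctions L m k → (Fin k → M) → M
  | 0, _ => fun f => Structure.funMap (L := L) f.down
  | m + 1, _ => Sum.elim (stageFunMap m) fun φ x => Classical.epsilon fun y =>
      @BoundedFormula.Realize (FirstOrder.Language.mk (StageFunctions L m) L.Relations) M
        ⟨fun f => stageFunMap m f, fun R => Structure.RelMap (L := L) R⟩ _ _ φ default (Fin.snoc x y)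

/-- The expansion of `M` to a stage of the Skolem expansion. -/
noncomputable instance stageStructure (m : ℕ) : (stage L m).Structure M where
  funMap f := stageFunMap L M m f
  RelMap R := Structure.RelMap (L := L) R

/-- The expansion of `M` to the Skolem expansion. It is defined directly from the stages, like
`skolemLang`, and not as a union; `stageToSkolem_isExpansionOn` says that it extends each stage. -/
noncomputable instance skolemStructure : (skolemLang L).Structure M where
  funMap f := Sum.elim (fun f => Structure.funMap (L := L) f)
    (fun φ x => Classical.epsilon fun y => φ.2.Realize (default : Empty → M) (Fin.snoc x y)) f
  RelMap R := Structure.RelMap (L := L) R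

instance inclusion_isExpansionOn : (inclusion L).IsExpansionOn M where
  map_onFunction _ _ := rfl
  map_onRelation _ _ := rfl

theorem funMap_stageFunctionsToSkolem : ∀ (m k : ℕ) (f : StageFunctions L m k) (x : Fin k → M),
    Structure.funMap (L := skolemLang L) (stageFunctionsToSkolem L m k f) x = stageFunMap L M m f x
  | 0, _, _, _ => rfl
  | m + 1, k, Sum.inl f, x => funMap_stageFunctionsToSkolem m k f x
  | _ + 1, _, Sum.inr _, _ => rfl

instance stageToSkolem_isExpansionOn (m : ℕ) : (stageToSkolem L m).IsExpansionOn M where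
  map_onFunction f x := funMap_stageFunctionsToSkolem L M m _ f x
  map_onRelation _ _ := rfl

instance model_skolemTheory : M ⊨ skolemTheory L := by
  refine ⟨?_⟩
  rintro _ ⟨m, k, φ, rfl⟩
  refine BoundedFormula.realize_alls.2 fun x => ?_
  rw [BoundedFormula.realize_imp, BoundedFormula.realize_ex, BoundedFormula.realize_ex]
  intro h
  refine ⟨Structure.funMap (L := skolemLang L) (Sum.inr ⟨m, φ⟩) x, ?_⟩
  rw [BoundedFormula.realize_inf, BoundedFormula.realize_bdEqual]
  constructor
  · simp [Term.realize]
  · simp only [LHom.realize_onBoundedFormula] at h ⊢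
    exact Classical.epsilon_spec h

end SkolemStructure

/-! ### Satisfaction of the axioms -/

theorem model_linearOrderAxioms {L : FirstOrder.Language.{u, v}} {M : Type u'} [L.Structure M]
    [LinearOrder M] (R : L.Relations 2) (hlt : ∀ a b : M, a < b ↔ Structure.RelMap R ![a, b]) :
    M ⊨ linearOrderAxioms R := by
  have hR : (fun a b : M => Structure.RelMap R ![a, b]) = (· < ·) :=
    funext₂ fun a b => propext (hlt a b).symm
  refine ⟨?_⟩
  rintro _ (rfl | rfl | rfl)
  · rw [Relations.realize_irreflexive, hR]
    infer_instance
  · rw [Relations.realize_transitive, hR]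
    infer_instance
  · simp only [Sentence.Realize, Formula.Realize, BoundedFormula.realize_all,
      BoundedFormula.realize_sup, BoundedFormula.realize_rel₂, BoundedFormula.realize_bdEqual, ← hlt]
    intro a b
    rcases lt_trichotomy a b with h | h | h
    exacts [Or.inl (Or.inl h), Or.inl (Or.inr h), Or.inr h]

section Satisfaction

variable {L : FirstOrder.Language.{u, v}} {lt : L.Relations 2} {M : Type u'} [L.Structure M]
  [Nonempty M] {I : Type w} {J : I → Type w}

/-- The value of a term at the increasing enumeration of a finite set, if the set has as
many elements as the term has variables, and an arbitrary element otherwise. -/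
noncomputable def termVal [LinearOrder M] (τ : Σ n, (skolemLang L).Term (Fin n)) (s : Finset M) :
    M :=
  if h : s.card = τ.1 then τ.2.realize (s.orderEmbOfFin h) else Classical.arbitrary M

theorem termVal_image [LinearOrder M] {n : ℕ} (τ : (skolemLang L).Term (Fin n)) {g : Fin n → M}
    (hg : StrictMono g) : termVal ⟨n, τ⟩ (Finset.univ.image g) = τ.realize g := by
  have h : (Finset.univ.image g).card = n := by
    rw [Finset.card_image_of_injective _ hg.injective, Finset.card_fin]
  rw [termVal, dif_pos h, ← Finset.orderEmbOfFin_unique h (by simp) hg]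

theorem realize_cst (c : Index I J → M) (p : Index I J) (x : Empty ⊕ Fin 0 → M) :
    letI := constantsOn.structure c
    (cst L p).realize x = c p := by
  let := constantsOn.structure c
  exact Term.realize_constants

theorem model_liftTheory [LinearOrder I] [∀ i, LinearOrder (J i)] {T : L.Theory}
    (hT : M ⊨ T) [(constantsOn (Index I J)).Structure M] : M ⊨ liftTheory T I J := by
  have : (((skolemLang L).lhomWithConstants (Index I J)).comp (inclusion L)).IsExpansionOn M :=
    ⟨fun f x => rfl, fun R x => rfl⟩
  rw [liftTheory, LHom.onTheory_model]
  exact hT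

theorem realize_termAt (c : Index I J → M) {n : ℕ} (τ : (skolemLang L).Term (Fin n))
    (p : Fin n → Index I J) (x : Empty ⊕ Fin 0 → M) :
    letI := constantsOn.structure c
    (termAt τ p).realize x = τ.realize (c ∘ p) := by
  let := constantsOn.structure c
  rw [termAt, Term.realize_subst, LHom.realize_onTerm]
  simp only [realize_cst]
  rfl

variable [LinearOrder M]

theorem realize_ltSentence (hlt : ∀ a b : M, a < b ↔ Structure.RelMap lt ![a, b])
    [(constantsOn (Index I J)).Structure M] (s t : (constLang L I J).Term (Empty ⊕ Fin 0)) :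
    M ⊨ ltSentence lt s t ↔ s.realize (Sum.elim default default : _ → M) <
      t.realize (Sum.elim default default : _ → M) := by
  rw [hlt, Sentence.Realize, Formula.Realize, ltSentence, BoundedFormula.realize_rel₂, ltC,
    LHom.map_onRelation, LHom.map_onRelation]

variable [LinearOrder I] [∀ i, LinearOrder (J i)]

/-- Each sentence of `T + Σ₁` holds in `M` as soon as the interpretation of the constants is generic
for certain finitely many terms and constants. -/
theorem exists_support {T : L.Theory} (hT : M ⊨ T)
    (hlt : ∀ a b : M, a < b ↔ Structure.RelMap lt ![a, b]) {σ : (constLang L I J).Sentence}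
    (hσ : σ ∈ liftTheory T I J ∪ sigmaOne lt I J) :
    ∃ (F : Finset (Σ n, (skolemLang L).Term (Fin n))) (D : Finset (Index I J)),
      ∀ c : Index I J → M, IsGenericOn termVal F D c →
        letI := constantsOn.structure c
        M ⊨ σ := by
  classical
  rcases hσ with hσ | ((((hσ | hσ) | (⟨p, q, hpq, rfl⟩ | ⟨p, q, hpq, rfl⟩)) |
    ⟨n, τ, p, i, j, hp, hpi, rfl⟩) | ⟨n, τ, p, p', k, j, u, hp, hp', hk, hu, heq, hne, rfl⟩)
  · refine ⟨∅, ∅, fun c _ => ?_⟩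
    let := constantsOn.structure c
    exact (model_liftTheory hT).realize_of_mem σ hσ
  · refine ⟨∅, ∅, fun c _ => ?_⟩
    let := constantsOn.structure c
    have : M ⊨ ((skolemLang L).lhomWithConstants (Index I J)).onTheory (skolemTheory L) :=
      (LHom.onTheory_model _ _).2 inferInstance
    exact this.realize_of_mem σ hσ
  · refine ⟨∅, ∅, fun c _ => ?_⟩
    let := constantsOn.structure c
    refine (model_linearOrderAxioms (ltC L lt I J) fun a b => ?_).realize_of_mem σ hσ
    rw [hlt, ltC, LHom.map_onRelation, LHom.map_onRelation]
  · refine ⟨∅, {p, q}, fun c hc => ?_⟩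
    let := constantsOn.structure c
    rw [realize_ltSentence hlt, realize_cst, realize_cst]
    exact hc.lt p (by simp) q (by simp) hpq
  · refine ⟨∅, {p, q}, fun c hc => ?_⟩
    let := constantsOn.structure c
    rw [Sentence.realize_not, realize_ltSentence hlt, realize_cst, realize_cst, not_lt]
    rcases (not_lt.1 hpq).eq_or_lt with rfl | hqp
    · exact le_rfl
    · exact (hc.lt q (by simp) p (by simp) hqp).le
  · refine ⟨{⟨n, τ⟩}, insert (toLex ⟨i, j⟩) (Finset.univ.image p), fun c hc => ?_⟩
    let := constantsOn.structure c
    rw [realize_ltSentence hlt, realize_cst, realize_termAt]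
    have hmono : StrictMono (c ∘ p) := fun s t hst =>
      hc.lt _ (by simp) _ (by simp) (hp hst)
    rw [← termVal_image τ hmono, ← Finset.image_image]
    exact hc.val_lt _ (by simp) _ (Finset.subset_insert _ _) _ (by simp) (by simpa using hpi)
  · refine ⟨{⟨n + 1, τ⟩}, insert (toLex ⟨k, j⟩) (Finset.univ.image p ∪ Finset.univ.image p'),
      fun c hc => ?_⟩
    let := constantsOn.structure c
    have hmono : StrictMono (c ∘ p) := fun s t hst => hc.lt _ (by simp) _ (by simp) (hp hst)
    have hmono' : StrictMono (c ∘ p') := fun s t hst => hc.lt _ (by simp) _ (by simp) (hp' hst)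
    have himp : M ⊨ ltSentence lt (termAt τ p) (cst L (toLex ⟨k, j⟩)) →
        M ⊨ eqSentence (termAt τ p) (termAt τ p') := by
      rw [realize_ltSentence hlt, realize_cst, realize_termAt]
      intro h
      refine (realize_termAt c τ p _).trans (Eq.trans ?_ (realize_termAt c τ p' _).symm)
      -- `B` consists of the positions of the constants that are replaced
      let B : Finset (Fin (n + 1)) :=
        Finset.univ.filter fun t => (ofLex (p t)).1 = (ofLex (p (Fin.last n))).1
      have hsplit : ∀ g : Fin (n + 1) → Index I J,
          Finset.univ.image (c ∘ g) = (Bᶜ.image g).image c ∪ (B.image g).image c := by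
        intro g
        rw [← Finset.image_union, ← Finset.image_union, Finset.image_image, Finset.union_comm,
          Finset.union_compl]
      have hBc : Bᶜ.image p' = Bᶜ.image p :=
        Finset.image_congr fun t ht => heq t (by simpa [B] using ht)
      rw [← termVal_image τ hmono, hsplit] at h ⊢
      rw [← termVal_image τ hmono', hsplit, hBc]
      refine (hc.val_eq _ (by simp) _ ?_ _ _ _ u hu ?_ ?_ ?_ ?_ (toLex ⟨k, j⟩) (by simp) hk h).symm
      · refine Finset.image_subset_iff.2 fun t _ => by simp
      · intro x hx
        obtain ⟨t, ht, rfl⟩ := Finset.mem_image.1 hx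
        refine lt_of_le_of_ne ?_ (by simpa [B] using ht)
        rcases Sigma.Lex.le_def.1 (hp.monotone (Fin.le_last t)) with h | ⟨h, -⟩
        exacts [h.le, h.le]
      · intro x hx
        obtain ⟨t, ht, rfl⟩ := Finset.mem_image.1 hx
        simpa [B] using ht
      · intro x hx
        obtain ⟨t, ht, rfl⟩ := Finset.mem_image.1 hx
        exact hne t (by simpa [B] using ht)
      · rw [Finset.image_image, Finset.image_image, Finset.card_image_of_injective _ hmono.injective,
          Finset.card_image_of_injective _ hmono'.injective]
    exact himp

end Satisfaction

end SingularLike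

theorem theorem3p5
    {L : FirstOrder.Language.{u, v}}
    [Countable (Σ n, L.Functions n)] [Countable (Σ n, L.Relations n)]
    (lt : L.Relations 2) (T : L.Theory)
    (θ : Cardinal.{u'}) (hθ : θ.IsInaccessible)
    (M : Type u') [L.Structure M] (hT : M ⊨ T) (hM : SingularLike.IsLike lt M θ)
    (lam : Cardinal.{w}) (hlam : lam.IsSingular)
    (μ : lam.ord.cof.ord.ToType → Cardinal.{w}) (hμ : StrictMono μ)
    (hsup : IsLUB (Set.range μ) lam) :
    (SingularLike.liftTheory T lam.ord.cof.ord.ToType (fun i => (μ i).ord.ToType) ∪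
      SingularLike.sigmaOne lt lam.ord.cof.ord.ToType
        (fun i => (μ i).ord.ToType)).IsSatisfiable := by
  classical
  open SingularLike FirstOrder FirstOrder.Language in
  have hlin := hM.linear
  let : LinearOrder M := linearOrderOfSTO fun a b : M => Structure.RelMap lt ![a, b]
  have : Nonempty M := Cardinal.mk_ne_zero_iff.1 (hM.card_eq ▸ hθ.ne_zero)
  rw [Theory.isSatisfiable_iff_isFinitelySatisfiable]
  intro T₀ hT₀
  choose! F D hFD using fun σ (hσ : σ ∈ T₀) =>
    exists_support (σ := σ) hT (lt := lt) (fun _ _ => Iff.rfl) (hT₀ hσ)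
  obtain ⟨c, hc⟩ := exists_isGenericOn hθ hM.card_lt hM.card_eq termVal (T₀.biUnion F)
    (T₀.biUnion D)
  let := constantsOn.structure c
  have : M ⊨ (T₀ : Theory _) := ⟨fun σ hσ => hFD σ hσ c
    (hc.mono (Finset.subset_biUnion_of_mem F hσ) (Finset.subset_biUnion_of_mem D hσ))⟩
  exact Theory.Model.isSatisfiable M
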